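/- Let $n,k\ge1$ and $s\ge0$ be integers and let $Z\in\mathbb{R}^{n\times k}$ have orthonormal columns, i.e. $Z^TZ=I_k$. For $i\in[n]$ let $\ell_i^2=\|e_i^TZ\|_2^2$ be the $i$-th leverage score of $Z$ and let $p_i=\ell_i^2/k$. Let $\beta>0$ and let $q=(q_1,\dots,q_n)$ be a probability distribution on $[n]$ with $q_i\ge\beta p_i$ for all $i\in[n]$. Let $0<\varepsilon\le 1$ and $\delta>0$, and suppose $$s>\frac{144\,k\,\ln(2k/\delta)}{\beta\varepsilon^2}.$$ Pick row indices $i_1,\dots,i_s\in[n]$ independently and with replacement, with $\Pr[i_j=i]=q_i$ for all $j\in[s]$ and $i\in[n]$. Let $\Omega\in\mathbb{R}^{n\times s}$ be the sampling matrix with $\Omega_{i_j,j}=1$ for $j\in[s]$ and all other entries $0$, and let $D\in\mathbb{R}^{s\times s}$ be the diagonal rescaling matrix with $D_{jj}=1/\sqrt{q_{i_j}s}$. Write $\sigma_1(M)\ge\sigma_2(M)\ge\cdots$ for the singular values of a matrix $M$, with multiplicity and continued by zeros. Then with probability at least $1-\delta$, simultaneously for all $i\in[k]$, $$1-\varepsilon\le\sigma_i^2(D^T\Omega^TZ)\le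 1+\varepsilon .$$ Moreover, for every outcome of the sampling, these inequalities for all $i\in[k]$ are equivalent to $$1-\varepsilon\le\sigma_i^2(Z^T\Omega D)\le 1+\varepsilon\qquad\text{for all } i\in[k].$$ -/

import Mathlib

open scoped Matrix

noncomputable section

namespace LeverageSampling

/-- The `i`-th leverage score `‖eᵢᵀ Z‖₂²` (squared Euclidean norm of the `i`-th row) of a matrix
`Z` with orthonormal columns. -/
def leverageScore {n k : ℕ} (Z : Matrix (Fin n) (Fin k) ℝ) (i : Fin n) : ℝ :=
  ‖(WithLp.toLp 2 (Z i) : EuclideanSpace ℝ (Fin k))‖ ^ 2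

/-- The leverage score distribution `pᵢ = ‖eᵢᵀ Z‖₂² / k`. -/
def leverageDist {n k : ℕ} (Z : Matrix (Fin n) (Fin k) ℝ) (i : Fin n) : ℝ :=
  leverageScore Z i / k

/-- The `n × s` sampling matrix: column `j` is the standard basis vector of the picked row index
`idx j`. -/
def samplingMatrix {n s : ℕ} (idx : Fin s → Fin n) : Matrix (Fin n) (Fin s) ℝ :=
  Matrix.of fun i j => if idx j = i then 1 else 0

/-- The `s × s` diagonal rescaling matrix with `D j j = 1 / √(q i * s)`, where `i = idx j` is the
row index picked for column `j`. -/
def rescalingMatrix {n s : ℕ} (q : Fin n → ℝ) (idx : Fin s → Fin n) :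
    Matrix (Fin s) (Fin s) ℝ :=
  Matrix.diagonal fun j => 1 / √(q (idx j) * s)

/-- The random row indices `idx 0, …, idx (s - 1)` of the sampling procedure: they are picked
independently, with replacement, each equal to `i` with probability `q i`. -/
structure IsRandSampling {Ω : Type*} [MeasurableSpace Ω] (P : MeasureTheory.Measure Ω) {n s : ℕ}
    (q : Fin n → ℝ) (idx : Fin s → Ω → Fin n) : Prop where
  measurable : ∀ j, Measurable (idx j)
  indep : ProbabilityTheory.iIndepFun idx P
  law : ∀ j i, P {ω | idx j ω = i} = ENNReal.ofReal (q i)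

/-- The `i`-th singular value (indexed from `0`, in decreasing order with multiplicity, extended
by zeros) of a real matrix, viewed as a linear map between Euclidean spaces. -/
def singularValue {m n : ℕ} (A : Matrix (Fin m) (Fin n) ℝ) (i : ℕ) : ℝ :=
  (Matrix.toEuclideanLin A).singularValues i

end LeverageSampling

end

/-! The Gram matrix of `Dᵀ * Ωᵀ * Z` is a sum of `s` independent rank-one PSD matrices with mean
`s⁻¹ • 1` (`sum_smul_rankOneSample`) and trace at most `r = k / (β * s)` (`trace_rankOneSample_le`).
Its eigenvalues are the squared singular values, so the claim is a matrix Chernoff bound,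
`sum_prod_le_of_exists_eigenvalue`.

That bound is Laplace's method with traces: an eigenvalue outside `[1 - ε, 1 + ε]` makes `tr exp (θ
• sum)` large for `θ = ±ε / (2 * r)`, while Golden–Thompson (`trace_exp_add_le`) bounds its mean by
peeling off one sample at a time. Golden–Thompson itself follows from the Lie–Trotter formula and a
dyadic Lieb–Thirring inequality.

The transposed form holds because `Mᵀ * M` and `M * Mᵀ` have the same characteristic polynomial up
to a power of `X`. -/

noncomputable section

namespace LeverageSampling

open Filter Topology NormedSpace

/-! ### The Lie–Trotter product formula. -/

section LieTrotter

theorem norm_pow_sub_pow_le_mul {A : Type*} [NormedRing A] [NormOneClass A] {x y : A} {C : ℝ}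
    (hC : 1 ≤ C) (hx : ‖x‖ ≤ C) (hy : ‖y‖ ≤ C) (N : ℕ) :
    ‖x ^ N - y ^ N‖ ≤ N * C ^ N * ‖x - y‖ := by
  induction N with
  | zero => simp
  | succ N ih =>
    have e : x ^ (N + 1) - y ^ (N + 1) = (x ^ N - y ^ N) * x + y ^ N * (x - y) := by
      rw [pow_succ, pow_succ]; noncomm_ring
    have h1 : ‖(x ^ N - y ^ N) * x‖ ≤ N * C ^ N * ‖x - y‖ * C :=
      (norm_mul_le _ _).trans (by gcongr)
    have h2 : ‖y ^ N * (x - y)‖ ≤ C ^ (N + 1) * ‖x - y‖ := by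
      refine (norm_mul_le _ _).trans ?_
      gcongr
      calc ‖y ^ N‖ ≤ ‖y‖ ^ N := norm_pow_le _ _
        _ ≤ C ^ N := by gcongr
        _ ≤ C ^ (N + 1) := pow_le_pow_right₀ hC (Nat.le_succ N)
    rw [e]
    refine (norm_add_le _ _).trans ((add_le_add h1 h2).trans (le_of_eq ?_))
    push_cast
    ring

/-- Both values at `1 / N` have norm at most `1 + C / N`, so their `N`-th powers stay below `exp C`.
Equal derivatives make the values differ by `o(1 / N)`, and telescoping the powers costs only a
factor `N`. -/
theorem tendsto_pow_sub_pow_of_hasDerivAt {A : Type*} [NormedRing A] [NormOneClass A]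
    [NormedAlgebra ℝ A] {g h : ℝ → A} {D : A} (hg : HasDerivAt g D 0) (hh : HasDerivAt h D 0)
    (hg0 : g 0 = 1) (hh0 : h 0 = 1) :
    Tendsto (fun N : ℕ => g (N : ℝ)⁻¹ ^ N - h (N : ℝ)⁻¹ ^ N) atTop (𝓝 0) := by
  have hlim : Tendsto (fun N : ℕ => (N : ℝ)⁻¹) atTop (𝓝 0) := tendsto_inv_atTop_nhds_zero_nat
  have bound : ∀ f : ℝ → A, HasDerivAt f D 0 → f 0 = 1 →
      ∃ C : ℝ, 0 ≤ C ∧ ∀ᶠ N : ℕ in atTop, ‖f (N : ℝ)⁻¹‖ ≤ 1 + C / N := by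
    intro f hf hf0
    obtain ⟨C, hC0, hC⟩ := hf.isBigO_sub.exists_nonneg
    refine ⟨C, hC0, ?_⟩
    filter_upwards [hlim.eventually hC.bound] with N hN
    rw [hf0, sub_zero, Real.norm_of_nonneg (by positivity)] at hN
    calc ‖f (N : ℝ)⁻¹‖ = ‖1 + (f (N : ℝ)⁻¹ - 1)‖ := by rw [add_sub_cancel]
      _ ≤ 1 + ‖f (N : ℝ)⁻¹ - 1‖ := by simpa using norm_add_le (1 : A) (f (N : ℝ)⁻¹ - 1)
      _ ≤ 1 + C / N := by rw [div_eq_mul_inv]; gcongr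
  obtain ⟨C₁, hC₁, h₁⟩ := bound g hg hg0
  obtain ⟨C₂, hC₂, h₂⟩ := bound h hh hh0
  have hlo := (hg.sub hh).isLittleO
  simp only [Pi.sub_apply, hg0, hh0, sub_self, sub_zero, smul_zero] at hlo
  have hlo' : Tendsto (fun N : ℕ => Real.exp (C₁ + C₂) * (N * ‖g (N : ℝ)⁻¹ - h (N : ℝ)⁻¹‖)) atTop
      (𝓝 0) := by
    have := ((hlo.norm_left).comp_tendsto hlim).tendsto_div_nhds_zero.const_mul
      (Real.exp (C₁ + C₂))
    simpa [Function.comp_def, div_eq_mul_inv, mul_comm] using this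
  refine squeeze_zero_norm' ?_ hlo'
  filter_upwards [h₁, h₂, eventually_gt_atTop 0] with N hN₁ hN₂ hN
  have hN' : (0 : ℝ) < N := by exact_mod_cast hN
  have hle : 1 + (C₁ + C₂) / N ≤ Real.exp ((C₁ + C₂) / N) := by
    rw [add_comm]; exact Real.add_one_le_exp _
  have hp : (1 + (C₁ + C₂) / N) ^ N ≤ Real.exp (C₁ + C₂) := by
    calc (1 + (C₁ + C₂) / N) ^ N ≤ Real.exp ((C₁ + C₂) / N) ^ N := by gcongr
      _ = Real.exp (C₁ + C₂) := by
        rw [← Real.exp_nat_mul, mul_div_cancel₀ _ hN'.ne']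
  have h0 : 1 ≤ 1 + (C₁ + C₂) / N := by
    have : 0 ≤ (C₁ + C₂) / N := by positivity
    linarith
  refine (norm_pow_sub_pow_le_mul h0 (hN₁.trans ?_) (hN₂.trans ?_) N).trans ?_
  · gcongr; linarith
  · gcongr; linarith
  · calc _ = (1 + (C₁ + C₂) / N) ^ N * (N * ‖g (N : ℝ)⁻¹ - h (N : ℝ)⁻¹‖) := by ring
      _ ≤ _ := by gcongr

/-- The Lie–Trotter product formula. -/
theorem tendsto_exp_smul_mul_exp_smul_pow {A : Type*} [NormedRing A] [NormOneClass A]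
    [NormedAlgebra ℝ A] [CompleteSpace A] (a b : A) :
    Tendsto (fun N : ℕ => (exp ((N : ℝ)⁻¹ • a) * exp ((N : ℝ)⁻¹ • b)) ^ N) atTop
      (𝓝 (exp (a + b))) := by
  let _ : NormedAlgebra ℚ A := NormedAlgebra.restrictScalars ℚ ℝ A
  have hexp : ∀ x : A, HasDerivAt (fun t : ℝ => exp (t • x)) x 0 := fun x => by
    simpa using hasDerivAt_exp_smul_const x (0 : ℝ)
  have hmul : HasDerivAt (fun t : ℝ => exp (t • a) * exp (t • b)) (a + b) 0 :=
    ((hexp a).mul (hexp b)).congr_deriv (by simp)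
  have key := tendsto_pow_sub_pow_of_hasDerivAt hmul (hexp (a + b)) (by simp) (by simp)
  have := key.add_const (exp (a + b))
  rw [zero_add] at this
  refine this.congr' ?_
  filter_upwards [eventually_gt_atTop 0] with N hN
  have : exp ((N : ℝ)⁻¹ • (a + b)) ^ N = exp (a + b) := by
    rw [← exp_nsmul, ← Nat.cast_smul_eq_nsmul ℝ, smul_smul, mul_inv_cancel₀ (by positivity),
      one_smul]
  simp only [this, sub_add_cancel]

end LieTrotter

/-! ### Trace inequalities up to Golden–Thompson. -/

section GoldenThompson

variable {m : Type*} [Fintype m]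

theorem trace_transpose_mul_self_nonneg (A : Matrix m m ℝ) : 0 ≤ (Aᵀ * A).trace := by
  simp only [Matrix.trace, Matrix.diag_apply, Matrix.mul_apply, Matrix.transpose_apply]
  exact Finset.sum_nonneg fun i _ => Finset.sum_nonneg fun j _ => mul_self_nonneg _

theorem two_mul_trace_transpose_mul_le (A B : Matrix m m ℝ) :
    2 * (Aᵀ * B).trace ≤ (Aᵀ * A).trace + (Bᵀ * B).trace := by
  have h := trace_transpose_mul_self_nonneg (A - B)
  have e : (Bᵀ * A).trace = (Aᵀ * B).trace := by
    rw [← Matrix.trace_transpose, Matrix.transpose_mul, Matrix.transpose_transpose]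
  rw [Matrix.transpose_sub, sub_mul, mul_sub, mul_sub, Matrix.trace_sub, Matrix.trace_sub,
    Matrix.trace_sub, e] at h
  linarith

variable [DecidableEq m]

theorem trace_mul_pow_comm (A B : Matrix m m ℝ) (N : ℕ) :
    ((A * B) ^ N).trace = ((B * A) ^ N).trace := by
  cases N with
  | zero => simp
  | succ N =>
    rw [pow_succ, ← mul_assoc, mul_pow_mul, mul_assoc, Matrix.trace_mul_comm,
      mul_assoc, ← pow_succ]

/-- The two claims need each other. The first, at `M * M`, reduces by cyclicity to the second for `M
* Mᵀ` and `Mᵀ * M`, then to `2 tr(AᵀB) ≤ tr(AᵀA) + tr(BᵀB)`. The second applies the first to `A *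
B`, then itself to `A ^ 2` and `B ^ 2`. -/
theorem trace_pow_two_pow_le_aux (p : ℕ) :
    (∀ M : Matrix m m ℝ, (M ^ 2 ^ (p + 1)).trace ≤ ((Mᵀ * M) ^ 2 ^ p).trace) ∧
    ∀ A B : Matrix m m ℝ, Aᵀ = A → Bᵀ = B →
      ((A * B) ^ 2 ^ p).trace ≤ (A ^ 2 ^ p * B ^ 2 ^ p).trace := by
  induction p with
  | zero =>
    refine ⟨fun M => ?_, fun A B _ _ => by simp⟩
    have h := two_mul_trace_transpose_mul_le Mᵀ M
    rw [Matrix.transpose_transpose, Matrix.trace_mul_comm M Mᵀ] at h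
    simp only [zero_add, pow_one, pow_zero, pow_two]
    linarith
  | succ p ih =>
    obtain ⟨ihW, ihL⟩ := ih
    refine ⟨fun M => ?_, fun A B hA hB => ?_⟩
    · have hsA : (M * Mᵀ)ᵀ = M * Mᵀ := by simp
      have hsB : (Mᵀ * M)ᵀ = Mᵀ * M := by simp
      have h1 := ihW (M * M)
      have h2 : (((M * M)ᵀ * (M * M)) ^ 2 ^ p).trace = ((M * Mᵀ * (Mᵀ * M)) ^ 2 ^ p).trace := by
        rw [Matrix.transpose_mul, show Mᵀ * Mᵀ * (M * M) = Mᵀ * (Mᵀ * M * M) by noncomm_ring,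
          trace_mul_pow_comm, show Mᵀ * M * M * Mᵀ = (Mᵀ * M) * (M * Mᵀ) by noncomm_ring,
          trace_mul_pow_comm]
      have h3 := ihL _ _ hsA hsB
      have h4 := two_mul_trace_transpose_mul_le ((M * Mᵀ) ^ 2 ^ p) ((Mᵀ * M) ^ 2 ^ p)
      rw [Matrix.transpose_pow, Matrix.transpose_pow, hsA, hsB, ← pow_add, ← pow_add, ← two_mul,
        ← pow_succ', trace_mul_pow_comm M Mᵀ] at h4
      rw [show (M * M) ^ 2 ^ (p + 1) = M ^ 2 ^ (p + 1 + 1) by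
        rw [← pow_two, ← pow_mul, ← pow_succ']] at h1
      linarith
    · have h1 := ihW (A * B)
      have h2 : (((A * B)ᵀ * (A * B)) ^ 2 ^ p).trace = ((A ^ 2 * B ^ 2) ^ 2 ^ p).trace := by
        rw [Matrix.transpose_mul, hA, hB, show B * A * (A * B) = B * (A * A * B) by noncomm_ring,
          trace_mul_pow_comm, pow_two, pow_two, mul_assoc (A * A)]
      have h3 := ihL (A ^ 2) (B ^ 2) (by rw [Matrix.transpose_pow, hA])
        (by rw [Matrix.transpose_pow, hB])
      rw [← pow_mul, ← pow_mul, ← pow_succ'] at h3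
      linarith

/-- A Lieb–Thirring type inequality for dyadic exponents. -/
theorem trace_mul_pow_two_pow_le {A B : Matrix m m ℝ} (hA : Aᵀ = A) (hB : Bᵀ = B) (p : ℕ) :
    ((A * B) ^ 2 ^ p).trace ≤ (A ^ 2 ^ p * B ^ 2 ^ p).trace :=
  (trace_pow_two_pow_le_aux p).2 A B hA hB

/-- The Golden–Thompson inequality for real symmetric matrices. -/
theorem trace_exp_add_le {A B : Matrix m m ℝ} (hA : Aᵀ = A) (hB : Bᵀ = B) :
    (exp (A + B)).trace ≤ (exp A * exp B).trace := by
  -- Lie–Trotter is used with `‖1‖ = 1`, which requires a nonempty index type.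
  cases isEmpty_or_nonempty m with
  | inl h => simp [Matrix.trace]
  | inr h =>
    let _ : NormedRing (Matrix m m ℝ) := Matrix.linftyOpNormedRing
    let _ : NormedAlgebra ℝ (Matrix m m ℝ) := Matrix.linftyOpNormedAlgebra
    have hcont : Continuous (Matrix.trace : Matrix m m ℝ → ℝ) := continuous_id.matrix_trace
    have hpow : Tendsto (fun p : ℕ => 2 ^ p) atTop (atTop : Filter ℕ) :=
      tendsto_pow_atTop_atTop_of_one_lt one_lt_two
    have hlim := (hcont.tendsto _).comp ((tendsto_exp_smul_mul_exp_smul_pow A B).comp hpow)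
    refine le_of_tendsto hlim (Eventually.of_forall fun p => ?_)
    have hroot : ∀ C : Matrix m m ℝ, exp (((2 ^ p : ℕ) : ℝ)⁻¹ • C) ^ 2 ^ p = exp C := fun C => by
      rw [← Matrix.exp_nsmul, ← Nat.cast_smul_eq_nsmul ℝ, smul_smul,
        mul_inv_cancel₀ (by positivity), one_smul]
    have := trace_mul_pow_two_pow_le (A := exp (((2 ^ p : ℕ) : ℝ)⁻¹ • A))
      (B := exp (((2 ^ p : ℕ) : ℝ)⁻¹ • B))
      (by rw [← Matrix.exp_transpose, Matrix.transpose_smul, hA])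
      (by rw [← Matrix.exp_transpose, Matrix.transpose_smul, hB]) p
    rwa [hroot, hroot] at this

end GoldenThompson

/-! ### Scalar inequalities transferred to symmetric matrices. -/

section Spectral

variable {m : Type*} [Fintype m] [DecidableEq m]

theorem exp_smul_eq_conj_diagonal {A : Matrix m m ℝ} (hA : A.IsHermitian) (t : ℝ) :
    exp (t • A) = (hA.eigenvectorUnitary : Matrix m m ℝ) *
      Matrix.diagonal (fun i => Real.exp (t * hA.eigenvalues i)) *
        star (hA.eigenvectorUnitary : Matrix m m ℝ) := by
  set U : Matrix m m ℝ := (hA.eigenvectorUnitary : Matrix m m ℝ)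
  have hU : U * star U = 1 := Unitary.coe_mul_star_self hA.eigenvectorUnitary
  have hinv : U⁻¹ = star U := Matrix.inv_eq_right_inv hU
  have hunit : IsUnit U := IsUnit.of_mul_eq_one _ hU
  have hAd : A = U * Matrix.diagonal hA.eigenvalues * star U := by
    have := hA.spectral_theorem
    rwa [Unitary.conjStarAlgAut_apply] at this
  have hsm : t • A = U * Matrix.diagonal (fun i => t * hA.eigenvalues i) * U⁻¹ := by
    rw [hinv]
    conv_lhs => rw [hAd]
    rw [← Matrix.smul_mul, ← Matrix.mul_smul, ← Matrix.diagonal_smul]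
    rfl
  rw [hsm, Matrix.exp_conj _ _ hunit, Matrix.exp_diagonal, hinv]
  congr 3
  ext i
  rw [Pi.coe_exp, Real.exp_eq_exp_ℝ]

theorem exp_le_trace_exp_smul {A : Matrix m m ℝ} (hA : A.IsHermitian) (t : ℝ) (i : m) :
    Real.exp (t * hA.eigenvalues i) ≤ (exp (t • A)).trace := by
  rw [exp_smul_eq_conj_diagonal hA, Matrix.trace_mul_comm, ← mul_assoc,
    Unitary.coe_star_mul_self, one_mul, Matrix.trace_diagonal]
  exact Finset.single_le_sum (f := fun i => Real.exp (t * hA.eigenvalues i))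
    (fun j _ => (Real.exp_pos _).le) (Finset.mem_univ i)

/-- By convexity, the graph of `exp` between `0` and `τ` lies below its chord. -/
theorem exp_div_mul_le {r x : ℝ} (τ : ℝ) (hr : 0 < r) (hx : 0 ≤ x) (hxr : x ≤ r) :
    Real.exp (τ / r * x) ≤ 1 + (Real.exp τ - 1) / r * x := by
  have h := convexOn_exp.2 (Set.mem_univ (0 : ℝ)) (Set.mem_univ τ)
    (sub_nonneg.2 ((div_le_one hr).2 hxr)) (div_nonneg hx hr.le) (sub_add_cancel 1 (x / r))
  simp only [smul_eq_mul, mul_zero, zero_add, Real.exp_zero, mul_one] at h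
  calc Real.exp (τ / r * x) = Real.exp (x / r * τ) := by congr 1; ring
    _ ≤ _ := h
    _ = _ := by ring

theorem posSemidef_one_add_smul_sub_exp {X : Matrix m m ℝ} (hX : X.PosSemidef) {r : ℝ}
    (hr : 0 < r) (htr : X.trace ≤ r) (τ : ℝ) :
    (1 + ((Real.exp τ - 1) / r) • X - exp ((τ / r) • X)).PosSemidef := by
  have hA := hX.isHermitian
  set c := (Real.exp τ - 1) / r
  set U : Matrix m m ℝ := (hA.eigenvectorUnitary : Matrix m m ℝ) with hUdef
  have hU : U * star U = 1 := Unitary.coe_mul_star_self hA.eigenvectorUnitary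
  have hAd : X = U * Matrix.diagonal hA.eigenvalues * star U := by
    have := hA.spectral_theorem
    rwa [Unitary.conjStarAlgAut_apply] at this
  have hle : ∀ i, hA.eigenvalues i ≤ r := fun i => by
    refine le_trans ?_ htr
    rw [hA.trace_eq_sum_eigenvalues]
    exact Finset.single_le_sum (f := fun i => hA.eigenvalues i)
      (fun j _ => hX.eigenvalues_nonneg j) (Finset.mem_univ i)
  have hd : (Matrix.diagonal fun i => 1 + c * hA.eigenvalues i -
      Real.exp (τ / r * hA.eigenvalues i)).PosSemidef :=
    Matrix.PosSemidef.diagonal fun i =>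
      sub_nonneg.2 (exp_div_mul_le τ hr (hX.eigenvalues_nonneg i) (hle i))
  have e : 1 + c • X - exp ((τ / r) • X) = U * (Matrix.diagonal fun i =>
      1 + c * hA.eigenvalues i - Real.exp (τ / r * hA.eigenvalues i)) * Uᴴ := by
    have e1 : (Matrix.diagonal fun i => 1 + c * hA.eigenvalues i -
        Real.exp (τ / r * hA.eigenvalues i)) = 1 + c • Matrix.diagonal hA.eigenvalues -
          Matrix.diagonal fun i => Real.exp (τ / r * hA.eigenvalues i) := by
      rw [← Matrix.diagonal_one, ← Matrix.diagonal_smul, Matrix.diagonal_add,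
        Matrix.diagonal_sub]
      rfl
    rw [exp_smul_eq_conj_diagonal hA, e1, mul_sub, sub_mul, mul_add, add_mul, mul_one,
      ← Matrix.star_eq_conjTranspose, hU, Matrix.mul_smul, Matrix.smul_mul, ← hAd]
  rw [e]
  exact hd.mul_mul_conjTranspose_same U

/-- Writing `exp A` as the square of the symmetric `exp (A / 2)` turns the trace of the difference
into that of a congruence of a PSD matrix. -/
theorem trace_exp_mul_le {A Q : Matrix m m ℝ} (hA : Aᵀ = A) {c : ℝ}
    (hQ : (c • (1 : Matrix m m ℝ) - Q).PosSemidef) :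
    (exp A * Q).trace ≤ c * (exp A).trace := by
  have hsq : exp A = exp ((2 : ℝ)⁻¹ • A) * (exp ((2 : ℝ)⁻¹ • A))ᴴ := by
    rw [← Matrix.exp_conjTranspose, Matrix.conjTranspose_smul,
      Matrix.conjTranspose_eq_transpose_of_trivial, hA, star_trivial, ← pow_two,
      ← Matrix.exp_nsmul, ← Nat.cast_smul_eq_nsmul ℝ, smul_smul]
    norm_num
  have h : 0 ≤ (exp A * (c • (1 : Matrix m m ℝ) - Q)).trace := by
    rw [hsq, Matrix.trace_mul_comm, ← mul_assoc, Matrix.trace_mul_comm, ← mul_assoc]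
    exact (hQ.conjTranspose_mul_mul_same _).trace_nonneg
  rw [mul_sub, Matrix.mul_smul, mul_one, Matrix.trace_sub, Matrix.trace_smul, smul_eq_mul] at h
  linarith

end Spectral

/-! ### The matrix Chernoff bound. -/

section Chernoff

variable {m ι : Type*} [Fintype m] [DecidableEq m] [Fintype ι]

/-- Iterated Golden–Thompson: the trace of the exponential of a sum of independent identically
distributed symmetric matrices. -/
theorem sum_prod_mul_trace_exp_add_le {q : ι → ℝ} (hq : ∀ i, 0 ≤ q i) {H : ι → Matrix m m ℝ}
    (hH : ∀ i, (H i)ᵀ = H i) {c : ℝ} (hc : 0 ≤ c)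
    (hsum : (c • (1 : Matrix m m ℝ) - ∑ i, q i • exp (H i)).PosSemidef) (s : ℕ) :
    ∀ A : Matrix m m ℝ, Aᵀ = A →
      ∑ f : Fin s → ι, (∏ j, q (f j)) * (exp (A + ∑ j, H (f j))).trace ≤
        c ^ s * (exp A).trace := by
  induction s with
  | zero => intro A _; simp
  | succ s ih =>
    intro A hA
    -- Condition on the first sample and absorb it into `A`; this is why the induction is over all
    -- symmetric `A`.
    rw [← (Fin.consEquiv fun _ => ι).sum_comp, Fintype.sum_prod_type]
    calc _ = ∑ i, q i * ∑ g : Fin s → ι,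
          (∏ j, q (g j)) * (exp (A + H i + ∑ j, H (g j))).trace := by
          refine Finset.sum_congr rfl fun i _ => ?_
          rw [Finset.mul_sum]
          refine Finset.sum_congr rfl fun g _ => ?_
          simp only [Fin.consEquiv, Equiv.coe_fn_mk, Fin.prod_univ_succ, Fin.sum_univ_succ,
            Fin.cons_zero, Fin.cons_succ, add_assoc, mul_assoc]
      _ ≤ ∑ i, q i * (c ^ s * (exp A * exp (H i)).trace) := by
          gcongr with i
          · exact hq i
          · refine (ih (A + H i) (by rw [Matrix.transpose_add, hA, hH])).trans ?_
            gcongr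
            exact trace_exp_add_le hA (hH i)
      _ = c ^ s * (exp A * ∑ i, q i • exp (H i)).trace := by
          rw [Matrix.mul_sum, Matrix.trace_sum, Finset.mul_sum]
          refine Finset.sum_congr rfl fun i _ => ?_
          rw [Matrix.mul_smul, Matrix.trace_smul, smul_eq_mul]
          ring
      _ ≤ c ^ s * (c * (exp A).trace) := by
          gcongr
          exact trace_exp_mul_le hA hsum
      _ = c ^ (s + 1) * (exp A).trace := by ring

/-- The chord bound averages to `1 + c / s ≤ exp (c / s)`, and `s` such factors multiply to `exp c`.
-/
theorem sum_prod_mul_trace_exp_smul_le {q : ι → ℝ} (hq : ∀ i, 0 ≤ q i) (hq1 : ∑ i, q i = 1)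
    {X : ι → Matrix m m ℝ} (hX : ∀ i, (X i).PosSemidef) {r : ℝ} (hr : 0 < r)
    (htr : ∀ i, (X i).trace ≤ r) {s : ℕ} (hs : 0 < s)
    (hmean : ∑ i, q i • X i = (s : ℝ)⁻¹ • (1 : Matrix m m ℝ)) (τ : ℝ) :
    ∑ f : Fin s → ι, (∏ j, q (f j)) * (exp ((τ / r) • ∑ j, X (f j))).trace ≤
      Real.exp ((Real.exp τ - 1) / r) * Fintype.card m := by
  set c := (Real.exp τ - 1) / r
  have hs' : (0 : ℝ) < s := by exact_mod_cast hs
  have hH : ∀ i, ((τ / r) • X i)ᵀ = (τ / r) • X i := fun i => by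
    have := (hX i).isHermitian.eq
    rw [Matrix.conjTranspose_eq_transpose_of_trivial] at this
    rw [Matrix.transpose_smul, this]
  have hpsd : (Real.exp (c / s) • (1 : Matrix m m ℝ) -
      ∑ i, q i • exp ((τ / r) • X i)).PosSemidef := by
    have h1 : (∑ i, q i • (1 + c • X i - exp ((τ / r) • X i))).PosSemidef :=
      Matrix.posSemidef_sum _ fun i _ =>
        (posSemidef_one_add_smul_sub_exp (hX i) hr (htr i) τ).smul (hq i)
    have h2 : ((Real.exp (c / s) - (1 + c / s)) • (1 : Matrix m m ℝ)).PosSemidef := by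
      refine Matrix.PosSemidef.one.smul (sub_nonneg.2 ?_)
      rw [add_comm]
      exact Real.add_one_le_exp _
    have h3 : ∑ i, q i • (1 + c • X i - exp ((τ / r) • X i)) =
        (1 + c / s) • (1 : Matrix m m ℝ) - ∑ i, q i • exp ((τ / r) • X i) := by
      simp only [smul_sub, smul_add, Finset.sum_sub_distrib, Finset.sum_add_distrib]
      rw [← Finset.sum_smul, hq1]
      simp only [smul_comm _ c, ← Finset.smul_sum]
      rw [hmean, smul_smul, add_smul, div_eq_mul_inv c (s : ℝ), one_smul]
    have h4 := h2.add h1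
    rw [h3, ← add_sub_assoc, ← add_smul, sub_add_cancel] at h4
    exact h4
  have key := sum_prod_mul_trace_exp_add_le hq hH (Real.exp_pos _).le hpsd s 0 (by simp)
  simp only [zero_add, ← Finset.smul_sum] at key
  rw [← Real.exp_nat_mul, mul_div_cancel₀ _ hs'.ne'] at key
  simpa using key

/-- Matrix Chernoff tail: Laplace transform bound followed by Markov's inequality. -/
theorem sum_prod_le_of_le_trace_exp {q : ι → ℝ} (hq : ∀ i, 0 ≤ q i) (hq1 : ∑ i, q i = 1)
    {X : ι → Matrix m m ℝ} (hX : ∀ i, (X i).PosSemidef) {r : ℝ} (hr : 0 < r)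
    (htr : ∀ i, (X i).trace ≤ r) {s : ℕ} (hs : 0 < s)
    (hmean : ∑ i, q i • X i = (s : ℝ)⁻¹ • (1 : Matrix m m ℝ)) (τ a : ℝ)
    (B : Finset (Fin s → ι))
    (hB : ∀ f ∈ B, Real.exp (τ / r * a) ≤ (exp ((τ / r) • ∑ j, X (f j))).trace) :
    ∑ f ∈ B, ∏ j, q (f j) ≤ Fintype.card m * Real.exp ((Real.exp τ - 1 - τ * a) / r) := by
  have hnn : ∀ f : Fin s → ι, 0 ≤ ∏ j, q (f j) := fun f => Finset.prod_nonneg fun j _ => hq _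
  have hpos : ∀ f : Fin s → ι, 0 ≤ (exp ((τ / r) • ∑ j, X (f j))).trace := fun f => by
    have hA : (∑ j, X (f j)).IsHermitian :=
      (Matrix.posSemidef_sum _ fun j _ => hX (f j)).isHermitian
    cases isEmpty_or_nonempty m with
    | inl h => simp [Matrix.trace]
    | inr h =>
      exact (Real.exp_pos _).le.trans (exp_le_trace_exp_smul hA (τ / r) (Classical.arbitrary m))
  have hkey := sum_prod_mul_trace_exp_smul_le hq hq1 hX hr htr hs hmean τ
  generalize hw : (fun f : Fin s → ι => ∏ j, q (f j)) = w at *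
  generalize hT : (fun f : Fin s → ι => (exp ((τ / r) • ∑ j, X (f j))).trace) = T at *
  replace hw := congrFun hw
  replace hT := congrFun hT
  simp only [hw, hT] at hnn hpos hB hkey ⊢
  have h1 : (∑ f ∈ B, w f) * Real.exp (τ / r * a) ≤
      Real.exp ((Real.exp τ - 1) / r) * Fintype.card m := by
    rw [Finset.sum_mul]
    calc _ ≤ ∑ f ∈ B, w f * T f :=
          Finset.sum_le_sum fun f hf => mul_le_mul_of_nonneg_left (hB f hf) (hnn f)
      _ ≤ ∑ f, w f * T f :=
          Finset.sum_le_sum_of_subset_of_nonneg (Finset.subset_univ B)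
            fun f _ _ => mul_nonneg (hnn f) (hpos f)
      _ ≤ _ := hkey
  have h2 : Real.exp ((Real.exp τ - 1) / r) =
      Real.exp ((Real.exp τ - 1 - τ * a) / r) * Real.exp (τ / r * a) := by
    rw [← Real.exp_add]; congr 1; ring
  rw [h2] at h1
  refine le_of_mul_le_mul_right (h1.trans (le_of_eq (by ring))) (Real.exp_pos (τ / r * a))

/-- Two-sided matrix Chernoff bound for independent samples of a positive semidefinite matrix
whose sum has expectation the identity. -/
theorem sum_prod_le_of_exists_eigenvalue {q : ι → ℝ} (hq : ∀ i, 0 ≤ q i) (hq1 : ∑ i, q i = 1)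
    {X : ι → Matrix m m ℝ} (hX : ∀ i, (X i).PosSemidef) {r : ℝ} (hr : 0 < r)
    (htr : ∀ i, (X i).trace ≤ r) {s : ℕ} (hs : 0 < s)
    (hmean : ∑ i, q i • X i = (s : ℝ)⁻¹ • (1 : Matrix m m ℝ)) {ε : ℝ} (hε : 0 < ε) (hε1 : ε ≤ 1)
    (B : Finset (Fin s → ι))
    (hB : ∀ f ∈ B, ∃ (i : m) (h : (∑ j, X (f j)).IsHermitian),
      h.eigenvalues i < 1 - ε ∨ 1 + ε < h.eigenvalues i) :
    ∑ f ∈ B, ∏ j, q (f j) ≤ 2 * (Fintype.card m * Real.exp (-(ε ^ 2 / 4) / r)) := by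
  classical
  -- With `τ = ±ε / 2` and `a = 1 ± ε`, this gives `exp τ - 1 - τ * a ≤ ε ^ 2 / 4 - ε ^ 2 / 2`.
  have hquad : ∀ τ : ℝ, |τ| ≤ 1 → Real.exp τ - 1 - τ ≤ τ ^ 2 := fun τ hτ =>
    (le_abs_self _).trans (Real.abs_exp_sub_one_sub_id_le hτ)
  set lower := B.filter fun f => ∃ (i : m) (h : (∑ j, X (f j)).IsHermitian),
    h.eigenvalues i < 1 - ε
  set upper := B.filter fun f => ∃ (i : m) (h : (∑ j, X (f j)).IsHermitian),
    1 + ε < h.eigenvalues i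
  have hsub : B ⊆ lower ∪ upper := fun f hf => by
    obtain ⟨i, h, h' | h'⟩ := hB f hf
    · exact Finset.mem_union_left _ (Finset.mem_filter.2 ⟨hf, i, h, h'⟩)
    · exact Finset.mem_union_right _ (Finset.mem_filter.2 ⟨hf, i, h, h'⟩)
  have hnn : ∀ f : Fin s → ι, 0 ≤ ∏ j, q (f j) := fun f => Finset.prod_nonneg fun j _ => hq _
  have hl : ∑ f ∈ lower, ∏ j, q (f j) ≤ Fintype.card m * Real.exp (-(ε ^ 2 / 4) / r) := by
    refine (sum_prod_le_of_le_trace_exp hq hq1 hX hr htr hs hmean (-(ε / 2)) (1 - ε) lower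
      fun f hf => ?_).trans ?_
    · obtain ⟨-, i, h, hi⟩ := Finset.mem_filter.1 hf
      refine le_trans (Real.exp_le_exp.2 ?_) (exp_le_trace_exp_smul h _ i)
      exact mul_le_mul_of_nonpos_left hi.le (div_nonpos_of_nonpos_of_nonneg (by linarith) hr.le)
    · have := hquad (-(ε / 2)) (by rw [abs_neg, abs_of_pos (by linarith)]; linarith)
      gcongr
      nlinarith
  have hu : ∑ f ∈ upper, ∏ j, q (f j) ≤ Fintype.card m * Real.exp (-(ε ^ 2 / 4) / r) := by
    refine (sum_prod_le_of_le_trace_exp hq hq1 hX hr htr hs hmean (ε / 2) (1 + ε) upper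
      fun f hf => ?_).trans ?_
    · obtain ⟨-, i, h, hi⟩ := Finset.mem_filter.1 hf
      refine le_trans (Real.exp_le_exp.2 ?_) (exp_le_trace_exp_smul h _ i)
      exact mul_le_mul_of_nonneg_left hi.le (by positivity)
    · have := hquad (ε / 2) (by rw [abs_of_pos (by linarith)]; linarith)
      gcongr
      nlinarith
  calc _ ≤ ∑ f ∈ lower ∪ upper, ∏ j, q (f j) :=
        Finset.sum_le_sum_of_subset_of_nonneg hsub fun f _ _ => hnn f
    _ ≤ ∑ f ∈ lower, ∏ j, q (f j) + ∑ f ∈ upper, ∏ j, q (f j) := by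
        rw [← Finset.sum_union_inter]
        exact le_add_of_nonneg_right (Finset.sum_nonneg fun f _ => hnn f)
    _ ≤ _ := by linarith

end Chernoff

/-! ### Singular values as eigenvalues of the Gram matrix, and transposition. -/

section SingularValues

theorem singularValue_nonneg {a b : ℕ} (M : Matrix (Fin a) (Fin b) ℝ) (i : ℕ) :
    0 ≤ singularValue M i :=
  LinearMap.singularValues_nonneg _ i

theorem adjoint_comp_self_toEuclideanLin {a b : ℕ} (M : Matrix (Fin a) (Fin b) ℝ) :
    LinearMap.adjoint (Matrix.toEuclideanLin M) ∘ₗ Matrix.toEuclideanLin M =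
      Matrix.toEuclideanLin (Mᵀ * M) := by
  rw [← Matrix.toEuclideanLin_conjTranspose_eq_adjoint,
    Matrix.conjTranspose_eq_transpose_of_trivial, Matrix.toLpLin_mul]

theorem exists_eigenvalues_eq_sq_singularValue {a b : ℕ} (M : Matrix (Fin a) (Fin b) ℝ)
    (h : (Mᵀ * M).IsHermitian) (i : Fin b) :
    ∃ j, h.eigenvalues j = singularValue M i ^ 2 := by
  have h1 := (Matrix.toEuclideanLin M).hasEigenvalue_adjoint_comp_self_sq_singularValues
    (n := i) (by simp)
  have h2 := h1.mem_spectrum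
  rw [adjoint_comp_self_toEuclideanLin, Matrix.spectrum_toLpLin,
    h.spectrum_real_eq_range_eigenvalues] at h2
  exact h2

theorem coe_ofFn_sq_singularValue {a b : ℕ} (M : Matrix (Fin a) (Fin b) ℝ) :
    ((List.ofFn fun i : Fin b => singularValue M i ^ 2 : List ℝ) : Multiset ℝ) =
      (Mᵀ * M).charpoly.roots := by
  have hb : Module.finrank ℝ (EuclideanSpace ℝ (Fin b)) = b := by simp
  have h := (Matrix.toEuclideanLin M).isSymmetric_adjoint_comp_self.roots_charpoly_eq_eigenvalues hb
  have hc : (LinearMap.adjoint (Matrix.toEuclideanLin M) ∘ₗ Matrix.toEuclideanLin M).charpoly =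
      (Mᵀ * M).charpoly := by
    rw [adjoint_comp_self_toEuclideanLin]
    exact Matrix.charpoly_toLin _ (PiLp.basisFun 2 ℝ (Fin b))
  rw [hc] at h
  rw [h, Fin.univ_val_map]
  congr 2
  funext i
  exact LinearMap.sq_singularValues_fin _ hb i

theorem getD_ofFn_sq_singularValue {a b : ℕ} (M : Matrix (Fin a) (Fin b) ℝ) (i : ℕ) :
    (List.ofFn fun i : Fin b => singularValue M i ^ 2).getD i 0 = singularValue M i ^ 2 := by
  by_cases hi : i < b
  · simp [List.getD, hi]
  · have : singularValue M i = 0 :=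
      LinearMap.singularValues_of_finrank_le _ (by simpa using hi)
    simp [List.getD, hi, this]

theorem sortedGE_ofFn_sq_singularValue {a b : ℕ} (M : Matrix (Fin a) (Fin b) ℝ) :
    (List.ofFn fun i : Fin b => singularValue M i ^ 2).SortedGE := by
  refine Antitone.sortedGE_ofFn fun i j hij => ?_
  have := singularValue_nonneg M j
  have := (Matrix.toEuclideanLin M).singularValues_antitone (Fin.val_fin_le.2 hij)
  simp only [singularValue] at *
  gcongr

/-- The characteristic polynomials of `Mᵀ * M` and `M * Mᵀ` differ by `X ^ (b - a)`, so the root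
multisets differ by zeros. Decreasing lists with the same multiset coincide. -/
theorem singularValue_transpose_of_le {a b : ℕ} (hab : a ≤ b) (M : Matrix (Fin a) (Fin b) ℝ)
    (i : ℕ) : singularValue Mᵀ i = singularValue M i := by
  set L := List.ofFn fun i : Fin b => singularValue M i ^ 2
  set L' := List.ofFn fun i : Fin a => singularValue Mᵀ i ^ 2
  have hroots : (L : Multiset ℝ) = (L' ++ List.replicate (b - a) 0 : List ℝ) := by
    have hc := Matrix.charpoly_mul_comm_of_le Mᵀ M (by simpa using hab)
    rw [← Multiset.coe_add, coe_ofFn_sq_singularValue, coe_ofFn_sq_singularValue,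
      Matrix.transpose_transpose, hc, Polynomial.roots_mul, Polynomial.roots_X_pow, add_comm,
      Multiset.nsmul_singleton, Multiset.coe_replicate]
    · simp
    · rw [← hc]; exact (Matrix.charpoly_monic _).ne_zero
  have hsorted : (L' ++ List.replicate (b - a) 0).SortedGE := by
    rw [List.sortedGE_iff_pairwise, List.pairwise_append]
    refine ⟨(sortedGE_ofFn_sq_singularValue Mᵀ).pairwise, by simp [List.pairwise_replicate], ?_⟩
    intro x hx y hy
    obtain ⟨j, rfl⟩ := (List.mem_ofFn' _ _).1 hx
    rw [List.eq_of_mem_replicate hy]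
    positivity
  have heq : L = L' ++ List.replicate (b - a) 0 :=
    (Multiset.coe_eq_coe.1 hroots).eq_of_sortedGE (sortedGE_ofFn_sq_singularValue M) hsorted
  have hget : L.getD i 0 = L'.getD i 0 := by
    rw [heq]
    by_cases hi : i < L'.length
    · rw [List.getD_append _ _ _ _ hi]
    · rw [List.getD_append_right _ _ _ _ (by omega), List.getD_eq_default L' _ (by omega)]
      by_cases h : i - L'.length < b - a
      · rw [List.getD_replicate _ h]
      · rw [List.getD_eq_default _ _ (by simpa using h)]
  rw [getD_ofFn_sq_singularValue, getD_ofFn_sq_singularValue] at hget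
  exact ((sq_eq_sq₀ (singularValue_nonneg _ _) (singularValue_nonneg _ _)).1 hget).symm

theorem singularValue_transpose {a b : ℕ} (M : Matrix (Fin a) (Fin b) ℝ) (i : ℕ) :
    singularValue Mᵀ i = singularValue M i := by
  rcases le_total a b with h | h
  · exact singularValue_transpose_of_le h M i
  · simpa using (singularValue_transpose_of_le h Mᵀ i).symm

end SingularValues

/-! ### Mean and trace of one rescaled sample. -/

section RowSampling

/-- The rescaled rank-one matrix contributed by picking row `i`. -/
def rankOneSample {n k : ℕ} (s : ℕ) (Z : Matrix (Fin n) (Fin k) ℝ) (q : Fin n → ℝ) (i : Fin n) :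
    Matrix (Fin k) (Fin k) ℝ :=
  (1 / √(q i * s)) ^ 2 • Matrix.vecMulVec (Z i) (Z i)

variable {n k s : ℕ} (Z : Matrix (Fin n) (Fin k) ℝ) (q : Fin n → ℝ)

theorem rescaled_sample_apply (f : Fin s → Fin n) (j : Fin s) (c : Fin k) :
    ((rescalingMatrix q f)ᵀ * (samplingMatrix f)ᵀ * Z) j c =
      1 / √(q (f j) * s) * Z (f j) c := by
  rw [Matrix.mul_assoc, rescalingMatrix, Matrix.diagonal_transpose, Matrix.diagonal_mul,
    Matrix.mul_apply]
  simp [samplingMatrix]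

theorem transpose_mul_self_rescaled_sample (f : Fin s → Fin n) :
    ((rescalingMatrix q f)ᵀ * (samplingMatrix f)ᵀ * Z)ᵀ *
      ((rescalingMatrix q f)ᵀ * (samplingMatrix f)ᵀ * Z) = ∑ j, rankOneSample s Z q (f j) := by
  ext a b
  rw [Matrix.mul_apply, Matrix.sum_apply]
  refine Finset.sum_congr rfl fun j _ => ?_
  rw [Matrix.transpose_apply, rescaled_sample_apply, rescaled_sample_apply, rankOneSample,
    Matrix.smul_apply, Matrix.vecMulVec_apply, smul_eq_mul]
  ring

theorem posSemidef_rankOneSample (i : Fin n) : (rankOneSample s Z q i).PosSemidef := by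
  have := Matrix.posSemidef_vecMulVec_self_star (Z i)
  rw [star_trivial] at this
  exact this.smul (sq_nonneg _)

theorem leverageScore_eq_sum (i : Fin n) : leverageScore Z i = ∑ c, Z i c * Z i c := by
  rw [leverageScore, EuclideanSpace.norm_sq_eq]
  simp [pow_two]

variable {Z q} {β : ℝ}

theorem leverageScore_le (hβ : 0 < β) (hk : 0 < k)
    (hq : ∀ i, β * leverageDist Z i ≤ q i) (i : Fin n) : leverageScore Z i ≤ k / β * q i := by
  have hk' : (0 : ℝ) < k := by exact_mod_cast hk
  have h := hq i
  rw [leverageDist] at h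
  calc leverageScore Z i = k / β * (β * (leverageScore Z i / k)) := by field_simp
    _ ≤ k / β * q i := by gcongr

theorem trace_rankOneSample_le (hβ : 0 < β) (hk : 0 < k) (hs : 0 < s) (hq0 : ∀ i, 0 ≤ q i)
    (hq : ∀ i, β * leverageDist Z i ≤ q i) (i : Fin n) :
    (rankOneSample s Z q i).trace ≤ k / (β * s) := by
  have hs' : (0 : ℝ) < s := by exact_mod_cast hs
  have htr : (rankOneSample s Z q i).trace = (q i * s)⁻¹ * leverageScore Z i := by
    rw [rankOneSample, Matrix.trace_smul, Matrix.trace_vecMulVec, leverageScore_eq_sum, one_div,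
      inv_pow, Real.sq_sqrt (mul_nonneg (hq0 i) hs'.le), smul_eq_mul]
    rfl
  rw [htr]
  rcases (hq0 i).eq_or_lt with h0 | h0
  · rw [← h0, zero_mul, inv_zero, zero_mul]; positivity
  · calc _ ≤ (q i * s)⁻¹ * (k / β * q i) := by gcongr; exact leverageScore_le hβ hk hq i
      _ = _ := by field_simp

theorem sum_smul_rankOneSample (hZ : Zᵀ * Z = 1) (hβ : 0 < β) (hk : 0 < k) (hs : 0 < s)
    (hq0 : ∀ i, 0 ≤ q i) (hq : ∀ i, β * leverageDist Z i ≤ q i) :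
    ∑ i, q i • rankOneSample s Z q i = (s : ℝ)⁻¹ • (1 : Matrix (Fin k) (Fin k) ℝ) := by
  have hs' : (0 : ℝ) < s := by exact_mod_cast hs
  rw [← hZ]
  ext a b
  rw [Matrix.sum_apply, Matrix.smul_apply, Matrix.mul_apply, Finset.smul_sum]
  refine Finset.sum_congr rfl fun i _ => ?_
  rw [rankOneSample, one_div, inv_pow, Real.sq_sqrt (mul_nonneg (hq0 i) hs'.le)]
  simp only [Matrix.smul_apply, Matrix.vecMulVec_apply, Matrix.transpose_apply, smul_eq_mul]
  rcases (hq0 i).eq_or_lt with h0 | h0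
  -- If `q i = 0`, the leverage score is `0`, so row `i` of `Z` vanishes and its term in `Zᵀ * Z` is
  -- not missed.
  · have hle := leverageScore_le hβ hk hq i
    rw [← h0, mul_zero, leverageScore_eq_sum] at hle
    have hz := (Finset.sum_eq_zero_iff_of_nonneg fun c _ => mul_self_nonneg (Z i c)).1
      (le_antisymm hle (Finset.sum_nonneg fun c _ => mul_self_nonneg _)) a (Finset.mem_univ a)
    rw [mul_self_eq_zero.1 hz]
    ring
  · field_simp

end RowSampling

/-! ### From weighted sums over outcomes to the measure `P`. -/

section Probability

open MeasureTheory

variable {Ω : Type*} [MeasurableSpace Ω] {P : Measure Ω} {n s : ℕ} {q : Fin n → ℝ}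
  {idx : Fin s → Ω → Fin n}

theorem IsRandSampling.measure_eq_prod (h : IsRandSampling P q idx) (hq : ∀ i, 0 ≤ q i)
    (f : Fin s → Fin n) :
    P {ω | (fun j => idx j ω) = f} = ENNReal.ofReal (∏ j, q (f j)) := by
  have e : {ω | (fun j => idx j ω) = f} = ⋂ j, idx j ⁻¹' {f j} := by
    ext ω; simp [funext_iff]
  rw [e, h.indep.meas_iInter fun j => ⟨{f j}, measurableSet_singleton _, rfl⟩,
    ENNReal.ofReal_prod_of_nonneg fun j _ => hq _]
  exact Finset.prod_congr rfl fun j _ => h.law j (f j)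

theorem IsRandSampling.measure_mem_le (h : IsRandSampling P q idx) (hq : ∀ i, 0 ≤ q i)
    (B : Finset (Fin s → Fin n)) :
    P {ω | (fun j => idx j ω) ∈ B} ≤ ENNReal.ofReal (∑ f ∈ B, ∏ j, q (f j)) := by
  have e : {ω | (fun j => idx j ω) ∈ B} = ⋃ f ∈ B, {ω | (fun j => idx j ω) = f} := by
    ext ω; simp
  rw [e, ENNReal.ofReal_sum_of_nonneg fun f _ => Finset.prod_nonneg fun j _ => hq _]
  refine (measure_biUnion_finset_le B _).trans (Finset.sum_le_sum fun f _ => ?_)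
  rw [h.measure_eq_prod hq]

theorem ofReal_one_sub_le_measure [IsProbabilityMeasure P] {G : Set Ω} {δ : ℝ} (hδ : 0 ≤ δ)
    (h : P Gᶜ ≤ ENNReal.ofReal δ) : ENNReal.ofReal (1 - δ) ≤ P G := by
  rw [ENNReal.ofReal_sub _ hδ, ENNReal.ofReal_one, tsub_le_iff_right, ← measure_univ (μ := P)]
  calc P Set.univ = P (G ∪ Gᶜ) := by rw [Set.union_compl_self]
    _ ≤ P G + P Gᶜ := measure_union_le _ _
    _ ≤ _ := by gcongr

end Probability

/-- The exponent needs only the constant `4` in place of `144`. The slack is harmless because `δ ≤ 1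
≤ k` makes the logarithm nonnegative. -/
theorem two_mul_mul_exp_le {k : ℕ} {s : ℝ} (hk : 0 < k) {β ε δ : ℝ} (hβ : 0 < β) (hε : 0 < ε)
    (hδ : 0 < δ) (hδ1 : δ ≤ 1)
    (hs : 144 * (k : ℝ) * Real.log (2 * (k : ℝ) / δ) / (β * ε ^ 2) < s) :
    2 * ((k : ℝ) * Real.exp (-(ε ^ 2 / 4) / (k / (β * s)))) ≤ δ := by
  have hk' : (1 : ℝ) ≤ k := by exact_mod_cast hk
  have hL : 0 ≤ Real.log (2 * (k : ℝ) / δ) := Real.log_nonneg (by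
    rw [le_div_iff₀ hδ]; linarith)
  rw [div_lt_iff₀ (by positivity)] at hs
  have h1 : -(ε ^ 2 / 4) / (k / (β * s)) ≤ -Real.log (2 * (k : ℝ) / δ) := by
    have e : -(ε ^ 2 / 4) / (k / (β * s)) = -(s * (β * ε ^ 2) / 4 / k) := by field_simp
    rw [e, neg_le_neg_iff, le_div_iff₀ (by linarith)]
    nlinarith [mul_nonneg (zero_le_one.trans hk') hL]
  calc _ ≤ 2 * ((k : ℝ) * Real.exp (-Real.log (2 * (k : ℝ) / δ))) := by gcongr
    _ = δ := by
      rw [Real.exp_neg, Real.exp_log (by positivity)]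
      field_simp

end LeverageSampling

end

theorem mainTheorem10 {Ω : Type*} [MeasurableSpace Ω] (P : MeasureTheory.Measure Ω)
    [MeasureTheory.IsProbabilityMeasure P] (n k s : ℕ)
    (Z : Matrix (Fin n) (Fin k) ℝ) (hZ : Zᵀ * Z = 1)
    (β : ℝ) (hβ : 0 < β)
    (q : Fin n → ℝ) (hq_nonneg : ∀ i, 0 ≤ q i) (hq_sum : ∑ i, q i = 1)
    (hq : ∀ i, β * LeverageSampling.leverageDist Z i ≤ q i)
    (ε δ : ℝ) (hε : 0 < ε) (hε1 : ε ≤ 1) (hδ : 0 < δ)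
    (hs : 144 * (k : ℝ) * Real.log (2 * (k : ℝ) / δ) / (β * ε ^ 2) < (s : ℝ))
    (idx : Fin s → Ω → Fin n) (hidx : LeverageSampling.IsRandSampling P q idx)
    (S : Ω → Matrix (Fin n) (Fin s) ℝ)
    (hS : ∀ ω, S ω = LeverageSampling.samplingMatrix fun j => idx j ω)
    (D : Ω → Matrix (Fin s) (Fin s) ℝ)
    (hD : ∀ ω, D ω = LeverageSampling.rescalingMatrix q fun j => idx j ω) :
    ENNReal.ofReal (1 - δ) ≤
        P {ω | ∀ i : Fin k,
          1 - ε ≤ LeverageSampling.singularValue ((D ω)ᵀ * (S ω)ᵀ * Z) i ^ 2 ∧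
            LeverageSampling.singularValue ((D ω)ᵀ * (S ω)ᵀ * Z) i ^ 2 ≤ 1 + ε} ∧
      ∀ ω,
        (∀ i : Fin k,
          1 - ε ≤ LeverageSampling.singularValue ((D ω)ᵀ * (S ω)ᵀ * Z) i ^ 2 ∧
            LeverageSampling.singularValue ((D ω)ᵀ * (S ω)ᵀ * Z) i ^ 2 ≤ 1 + ε) ↔
        (∀ i : Fin k,
          1 - ε ≤ LeverageSampling.singularValue (Zᵀ * S ω * D ω) i ^ 2 ∧
            LeverageSampling.singularValue (Zᵀ * S ω * D ω) i ^ 2 ≤ 1 + ε) := by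
  obtain rfl : S = fun ω => LeverageSampling.samplingMatrix fun j => idx j ω := funext hS
  obtain rfl : D = fun ω => LeverageSampling.rescalingMatrix q fun j => idx j ω := funext hD
  refine ⟨?_, fun ω => ?_⟩
  · rcases Nat.eq_zero_or_pos k with rfl | hk
    · simp [hδ.le]
    -- For `δ ≥ 1` the probability bound is trivial; otherwise the logarithm is nonnegative, which
    -- forces `s > 0`.
    rcases le_total 1 δ with hδ1 | hδ1
    · rw [ENNReal.ofReal_of_nonpos (by linarith)]
      exact zero_le
    have hk' : (1 : ℝ) ≤ k := by exact_mod_cast hk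
    have hs0 : 0 < s := by
      have hL : 0 ≤ Real.log (2 * (k : ℝ) / δ) := Real.log_nonneg (by
        rw [le_div_iff₀ hδ]; linarith)
      have : (0 : ℝ) < s := lt_of_le_of_lt (by positivity) hs
      exact_mod_cast this
    have hs' : (0 : ℝ) < s := by exact_mod_cast hs0
    let M : (Fin s → Fin n) → Matrix (Fin s) (Fin k) ℝ := fun f =>
      (LeverageSampling.rescalingMatrix q f)ᵀ * (LeverageSampling.samplingMatrix f)ᵀ * Z
    classical
    let B : Finset (Fin s → Fin n) := Finset.univ.filter fun f =>
      ¬ ∀ i : Fin k, 1 - ε ≤ LeverageSampling.singularValue (M f) i ^ 2 ∧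
        LeverageSampling.singularValue (M f) i ^ 2 ≤ 1 + ε
    have hB : ∑ f ∈ B, ∏ j, q (f j) ≤ δ := by
      have h := LeverageSampling.sum_prod_le_of_exists_eigenvalue hq_nonneg hq_sum
        (LeverageSampling.posSemidef_rankOneSample (s := s) Z q)
        (r := k / (β * s)) (by positivity)
        (LeverageSampling.trace_rankOneSample_le hβ hk hs0 hq_nonneg hq) hs0
        (LeverageSampling.sum_smul_rankOneSample hZ hβ hk hs0 hq_nonneg hq) hε hε1 B
        fun f hf => by
          obtain ⟨i, hi⟩ := not_forall.1 (Finset.mem_filter.1 hf).2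
          have hM := LeverageSampling.transpose_mul_self_rescaled_sample Z q f
          have hH : ((M f)ᵀ * M f).IsHermitian := by
            simpa using Matrix.isHermitian_conjTranspose_mul_self (M f)
          obtain ⟨l, hl⟩ := LeverageSampling.exists_eigenvalues_eq_sq_singularValue (M f) hH i
          rw [← hM]
          refine ⟨l, hH, ?_⟩
          rw [hl]
          by_contra hcon
          exact hi (by simpa [not_or] using hcon)
      rw [Fintype.card_fin] at h
      exact h.trans (LeverageSampling.two_mul_mul_exp_le hk hβ hε hδ hδ1 hs)
    refine LeverageSampling.ofReal_one_sub_le_measure hδ.le (le_trans (le_of_eq ?_)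
      ((hidx.measure_mem_le hq_nonneg B).trans (ENNReal.ofReal_le_ofReal hB)))
    congr 1
    ext ω
    simp only [Set.mem_compl_iff, Set.mem_ofPred_eq, B, Finset.mem_filter, Finset.mem_univ,
      true_and, M]
  · have e : ∀ i : ℕ, LeverageSampling.singularValue
        (Zᵀ * (LeverageSampling.samplingMatrix fun j => idx j ω) *
          LeverageSampling.rescalingMatrix q fun j => idx j ω) i =
        LeverageSampling.singularValue
          ((LeverageSampling.rescalingMatrix q fun j => idx j ω)ᵀ *
            (LeverageSampling.samplingMatrix fun j => idx j ω)ᵀ * Z) i := fun i => by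
      rw [← LeverageSampling.singularValue_transpose]
      simp only [Matrix.transpose_mul, Matrix.transpose_transpose, Matrix.mul_assoc]
    simp only [e]
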